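/- Conventions. Let $r\ge 1$ and $n\ge 0$ be integers. For a real polynomial $f(x)$, let $f^{\langle r,0\rangle},\dots,f^{\langle r,r-1\rangle}$ be the unique polynomials with $f(x)=\sum_{k=0}^{r-1}x^k f^{\langle r,k\rangle}(x^r)$. For a real polynomial $h(x)$ and $0\le k\le r-1$ put $$U^n_{r,k}h(x)=\left((1+x+\cdots+x^{r-1})^n h(x)\right)^{\langle r,k\rangle};$$ equivalently, if $\sum_{i\ge0}a_ix^i=h(x)/(1-x)^n$, then $\sum_{i\ge0}a_{ri+k}x^i=U^n_{r,k}h(x)/(1-x)^n$. A real polynomial is real-rooted if it is zero or all its zeros are real. For nonzero real-rooted polynomials $g,f$ with positive leading coefficients, $g$ interlaces $f$ if $\deg f=\deg g$ or $\deg f=\deg g+1$, and $\cdots\le v_2\le u_2\le v_1\le u_1$, where $u_i$ and $v_j$ are the zeros of $f$ and $g$, respectively, listed with multiplicity. By convention the zero polynomial interlaces, and is interlaced by, every real-rooted polynomial. A sequence $(f_1,\dots,f_m)$ of real polynomials, each of which is zero or has positive leading coefficient, is interlacing if $f_i$ interlaces $f_j$ for all $1\le i<j\le m$. Corollary 3.1.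 Let $r\ge 1$ and $n\ge 0$ be integers, and let $h(x)$ be a real polynomial of degree at most $r$ with nonnegative coefficients. Then the sequence $$\left(U^n_{r,r-1}h(x),\ \dots,\ U^n_{r,1}h(x),\ U^n_{r,0}h(x)\right)$$ is interlacing, and $U^n_{r,j}h(x)$ is real-rooted for every $0\le j\le r-1$. In particular (the case $j=0$), if $h(x)$ has nonnegative coefficients and $\deg h\le r$, then $U^n_{r,0}h(x)$ has only real zeros or is zero. -/

import Mathlib

open Polynomial

noncomputable section

/-- The `r`-section `f^⟨r,k⟩` of a polynomial `f`: the polynomial whose `i`-th coefficient is the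
`(r i + k)`-th coefficient of `f`.  For `r ≥ 1` these are the unique polynomials with
`f(x) = ∑ k < r, x ^ k * f^⟨r,k⟩(x ^ r)`, see `veroneseSection_unique` and `sum_veroneseSection`. -/
def veroneseSection (r k : ℕ) (f : ℝ[X]) : ℝ[X] :=
  ∑ i ∈ Finset.range (f.natDegree + 1), monomial i (f.coeff (r * i + k))

/-- The operator `U^n_{r,k} h = ((1 + x + ⋯ + x^(r-1))^n * h)^⟨r,k⟩`.
By `veroneseU_eq_series`, if `∑ a_i x^i = h(x) / (1 - x)^n`, then
`∑ a_{r i + k} x^i = (U^n_{r,k} h)(x) / (1 - x)^n`. -/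
def veroneseU (n r k : ℕ) (h : ℝ[X]) : ℝ[X] :=
  veroneseSection r k ((∑ i ∈ Finset.range r, (X : ℝ[X]) ^ i) ^ n * h)

/-- All zeros of `p` are real, i.e. `p` is a product of a constant and linear factors over `ℝ`.
The zero polynomial counts as real-rooted. -/
def RealRooted (p : ℝ[X]) : Prop := p.Splits

/-- The real zeros of `p`, with multiplicity, in weakly decreasing order. -/
def zerosDesc (p : ℝ[X]) : List ℝ := p.roots.sort (fun a b => b ≤ a)

/-- Two weakly decreasing lists `u = [u₁, u₂, …]`, `v = [v₁, v₂, …]` alternate in the way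
`⋯ ≤ v₂ ≤ u₂ ≤ v₁ ≤ u₁`. -/
def Alternate (v u : List ℝ) : Prop :=
  (∀ (i : ℕ) (hv : i < v.length) (hu : i < u.length), v[i] ≤ u[i]) ∧
  (∀ (i : ℕ) (hv : i < v.length) (hu : i + 1 < u.length), u[i + 1] ≤ v[i])

/-- `g` interlaces `f`, for real-rooted `g` and `f`: either one of them is zero, or both have
positive leading coefficients, `deg f ∈ {deg g, deg g + 1}`, and the zeros `v` of `g` and `u` of `f`
satisfy `⋯ ≤ v₂ ≤ u₂ ≤ v₁ ≤ u₁`. -/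
def Interlaces (g f : ℝ[X]) : Prop :=
  RealRooted g ∧ RealRooted f ∧
    (g = 0 ∨ f = 0 ∨
      (0 < g.leadingCoeff ∧ 0 < f.leadingCoeff ∧
        (f.natDegree = g.natDegree ∨ f.natDegree = g.natDegree + 1) ∧
        Alternate (zerosDesc g) (zerosDesc f)))

/-- A finite sequence of polynomials, each zero or with positive leading coefficient, is
interlacing if `f i` interlaces `f j` for all `i < j`. -/
def IsInterlacingSeq {m : ℕ} (f : Fin m → ℝ[X]) : Prop :=
  (∀ i, f i = 0 ∨ 0 < (f i).leadingCoeff) ∧ ∀ i j, i < j → Interlaces (f i) (f j)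

/-- The convention that a nonnegative constant interlaces `b x + c` for `b, c ≥ 0` holds. -/
theorem interlaces_const_linear (a b c : ℝ) (ha : 0 ≤ a) (hb : 0 ≤ b) (hc : 0 ≤ c) :
    Interlaces (C a) (C b * X + C c) := by
  refine ⟨Splits.C a, Splits.of_natDegree_le_one natDegree_linear_le, ?_⟩
  rcases ha.eq_or_lt with rfl | ha
  · simp
  right
  rcases hb.eq_or_lt with rfl | hb
  · rcases hc.eq_or_lt with rfl | hc
    · simp
    · right
      simp [ha, hc, Alternate, zerosDesc]
  · right
    simp [ha, hb, Alternate, zerosDesc, leadingCoeff_linear hb.ne', natDegree_linear hb.ne']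

theorem coeff_veroneseSection {r : ℕ} (hr : 0 < r) (k : ℕ) (f : ℝ[X]) (i : ℕ) :
    (veroneseSection r k f).coeff i = f.coeff (r * i + k) := by
  simp only [veroneseSection, finsetSum_coeff, coeff_monomial, Finset.sum_ite_eq',
    Finset.mem_range]
  split_ifs with h
  · rfl
  · symm
    apply coeff_eq_zero_of_natDegree_lt
    nlinarith

/-- The sections are determined by the decomposition of `f`. -/
theorem veroneseSection_unique {r : ℕ} (hr : 0 < r) (f : ℝ[X]) (g : ℕ → ℝ[X])
    (hf : f = ∑ k ∈ Finset.range r, X ^ k * (g k).comp (X ^ r)) (k : ℕ) (hk : k < r) :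
    g k = veroneseSection r k f := by
  ext i
  rw [coeff_veroneseSection hr, hf, finsetSum_coeff, Finset.sum_eq_single k]
  · rw [← expand_eq_comp_X_pow, add_comm, coeff_X_pow_mul', if_pos (by omega),
      Nat.add_sub_cancel_left, mul_comm, coeff_expand_mul hr]
  · intro j hj hjk
    rw [Finset.mem_range] at hj
    rw [← expand_eq_comp_X_pow, coeff_X_pow_mul']
    split_ifs with hle
    · rw [coeff_expand hr, if_neg]
      intro hd
      apply hjk
      have h1 : r * i + k ≡ j [MOD r] := ((Nat.modEq_iff_dvd' hle).2 hd).symm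
      have h2 : k ≡ j [MOD r] := by
        have : r * i + k ≡ k [MOD r] := by simp [Nat.ModEq]
        exact this.symm.trans h1
      exact (Nat.ModEq.eq_of_lt_of_lt h2 hk hj).symm
    · rfl
  · intro hk'
    exact absurd (Finset.mem_range.2 hk) hk'

/-- The decomposition of `f` into its sections. -/
theorem sum_veroneseSection {r : ℕ} (hr : 0 < r) (f : ℝ[X]) :
    f = ∑ k ∈ Finset.range r, X ^ k * (veroneseSection r k f).comp (X ^ r) := by
  set F := ∑ k ∈ Finset.range r, X ^ k * (veroneseSection r k f).comp (X ^ r) with hF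
  ext m
  have hm : m % r < r := Nat.mod_lt _ hr
  have h := congrArg (fun p => p.coeff (m / r))
    (veroneseSection_unique hr F (fun k => veroneseSection r k f) hF (m % r) hm)
  simpa only [coeff_veroneseSection hr, Nat.div_add_mod] using h

/-- The generating function characterization of `U^n_{r,k} h`. -/
theorem veroneseU_eq_series {n r k : ℕ} (hk : k < r) (h : ℝ[X]) (a : ℕ → ℝ)
    (ha : PowerSeries.mk a * (1 - PowerSeries.X) ^ n = (h : PowerSeries ℝ)) :
    PowerSeries.mk (fun i => a (r * i + k)) * (1 - PowerSeries.X) ^ n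
      = (veroneseU n r k h : PowerSeries ℝ) := by
  have hr : 0 < r := by omega
  let S : PowerSeries ℝ → PowerSeries ℝ :=
    fun A => PowerSeries.mk (fun i => PowerSeries.coeff (r * i + k) A)
  have h1 : ∀ A, S (A * (1 - PowerSeries.X ^ r)) = S A * (1 - PowerSeries.X) := by
    intro A
    ext i
    simp only [S, mul_sub, mul_one, map_sub, PowerSeries.coeff_mk, PowerSeries.coeff_mul_X_pow']
    cases i with
    | zero => simp [hk]
    | succ i =>
      rw [PowerSeries.coeff_succ_mul_X, PowerSeries.coeff_mk,
        if_pos (by nlinarith), show r * (i + 1) + k - r = r * i + k by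
          rw [mul_add, mul_one]; omega]
  have h2 : ∀ (m : ℕ) A, S (A * (1 - PowerSeries.X ^ r) ^ m) = S A * (1 - PowerSeries.X) ^ m := by
    intro m
    induction m with
    | zero => intro A; simp
    | succ m ih => intro A; rw [pow_succ, ← mul_assoc, h1, ih, pow_succ, mul_assoc]
  have h3 : PowerSeries.mk a * (1 - PowerSeries.X ^ r) ^ n =
      (((∑ i ∈ Finset.range r, (X : ℝ[X]) ^ i) ^ n * h : ℝ[X]) : PowerSeries ℝ) := by
    have hg : ((∑ i ∈ Finset.range r, (X : ℝ[X]) ^ i : ℝ[X]) : PowerSeries ℝ)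
        * (1 - PowerSeries.X) = 1 - PowerSeries.X ^ r := by
      have := congrArg (fun p : ℝ[X] => (p : PowerSeries ℝ)) (geom_sum_mul_neg (X : ℝ[X]) r)
      simpa using this
    rw [Polynomial.coe_mul, Polynomial.coe_pow, ← ha, ← hg, mul_pow]
    ring
  have h4 := h2 n (PowerSeries.mk a)
  rw [h3] at h4
  simp only [S, PowerSeries.coeff_mk] at h4
  rw [← h4]
  ext i
  rw [PowerSeries.coeff_mk, Polynomial.coeff_coe, Polynomial.coeff_coe, veroneseU,
    coeff_veroneseSection hr]

end

/-!
For `z` in the upper half-plane consider the values at `z` of the sections `U^n_{r,k} h`, `k < r`.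
The proof maintains, by induction on `n`, that these values are ordered by decreasing argument
inside a sector of angle `arg z` (`SectorOrdered`, `sectorOrdered_veroneseU`), and that a section
which is not the zero polynomial does not vanish at `z` (`veroneseU_eq_zero_of_aeval_eq_zero`).
For `n = 0` the sections are constants and one linear polynomial. Passing from `n` to `n + 1`
multiplies by `1 + x + ⋯ + x^(r-1)`, which replaces the sections `f_k` by
`∑ j ≤ k, f_j + x ∑ j > k, f_j` (`veroneseU_succ`); the sector condition is bi-additive in the
values, and `SectorOrdered.cyclicSum` checks that it survives.

Nonvanishing on the upper half-plane gives real-rootedness. The first half of the sector condition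
says that `f / g` maps the upper half-plane to its closure when `f`, `g` are sections of index
`k < l`, and this yields that `g` interlaces `f` (`interlaces_of_im_nonneg`): the continuous
argument of `f / g` stays in `[0, π]`, and at a real boundary point `x` it equals `π` times the
number of zeros of `f` beyond `x` minus that of `g`, so this difference is always `0` or `1`.
-/

open Filter Topology ComplexConjugate

/-! ### Sectors of complex numbers -/

/-- The complex numbers `w 0, …, w (r - 1)` lie, in order of weakly decreasing argument, in a closed
sector whose opening angle is `arg z`. For `z` in the upper half-plane this is encoded by the two
conditions `0 ≤ arg (w k / w l)` and `arg (w k / w l) ≤ arg z`, for `k < l`, in a form that is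
bi-additive in `w` and meaningful for vanishing entries. -/
def SectorOrdered (z : ℂ) (r : ℕ) (w : ℕ → ℂ) : Prop :=
  ∀ k l, k < l → l < r → 0 ≤ (w k * conj (w l)).im ∧ 0 ≤ (z * w l * conj (w k)).im

theorem im_sum_mul_conj_sum_nonneg {ι κ : Type*} {s : Finset ι} {t : Finset κ} {u : ι → ℂ}
    {v : κ → ℂ} (h : ∀ i ∈ s, ∀ j ∈ t, 0 ≤ (u i * conj (v j)).im) :
    0 ≤ ((∑ i ∈ s, u i) * conj (∑ j ∈ t, v j)).im := by
  rw [map_sum, Finset.sum_mul_sum, Complex.im_sum]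
  refine Finset.sum_nonneg fun i hi => ?_
  rw [Complex.im_sum]
  exact Finset.sum_nonneg fun j hj => h i hi j hj

/-- The sector conditions are bi-additive, so they pass to sums over two consecutive blocks of
indices. -/
theorem SectorOrdered.sum {z : ℂ} {r : ℕ} {w : ℕ → ℂ} (hw : SectorOrdered z r w)
    {s t : Finset ℕ} (hst : ∀ i ∈ s, ∀ j ∈ t, i < j) (ht : ∀ j ∈ t, j < r) :
    0 ≤ ((∑ i ∈ s, w i) * conj (∑ j ∈ t, w j)).im ∧
      0 ≤ (z * (∑ j ∈ t, w j) * conj (∑ i ∈ s, w i)).im := by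
  refine ⟨im_sum_mul_conj_sum_nonneg fun i hi j hj => (hw i j (hst i hi j hj) (ht j hj)).1, ?_⟩
  rw [Finset.mul_sum]
  exact im_sum_mul_conj_sum_nonneg fun j hj i hi => (hw i j (hst i hi j hj) (ht j hj)).2

theorem eq_zero_of_add_mul_eq_zero {z a c : ℂ} (hz : 0 < z.im) (h : c + z * a = 0)
    (hca : 0 ≤ (c * conj a).im) : a = 0 := by
  have hc : c = -(z * a) := by linear_combination h
  have h1 : (c * conj a).im = -(z.im * Complex.normSq a) := by
    rw [hc, neg_mul, mul_assoc, Complex.mul_conj]; simp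
  rw [h1] at hca
  have h2 := Complex.normSq_nonneg a
  have h3 : Complex.normSq a = 0 := by nlinarith
  exact Complex.normSq_eq_zero.1 h3

/-- Since `arg z < π`, the sector is pointed, so a sum of its elements vanishes only if every
summand does. -/
theorem SectorOrdered.eq_zero_of_sum_eq_zero {z : ℂ} {r : ℕ} {w : ℕ → ℂ} (hz : 0 < z.im)
    (hw : SectorOrdered z r w) (s : Finset ℕ) (hs : ∀ j ∈ s, j < r)
    (h : ∑ j ∈ s, w j = 0) : ∀ j ∈ s, w j = 0 := by
  induction s using Finset.induction_on_min with
  | empty => simp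
  | insert a s ha ih =>
    have has : a ∉ s := fun h => lt_irrefl _ (ha a h)
    rw [Finset.sum_insert has] at h
    have hsp := (hw.sum (s := {a}) (t := s) (by simpa using ha)
      fun j hj => hs j (Finset.mem_insert_of_mem hj)).2
    rw [Finset.sum_singleton] at hsp
    have hwa : w a = 0 := by
      refine eq_zero_of_add_mul_eq_zero (c := z * ∑ j ∈ s, w j) hz ?_ hsp
      linear_combination z * h
    rw [hwa, zero_add] at h
    intro j hj
    rcases Finset.mem_insert.1 hj with rfl | hj
    · exact hwa
    · exact ih (fun j hj => hs j (Finset.mem_insert_of_mem hj)) h j hj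

/-- The `k`-th entry of the linear transformation that multiplication by `1 + x + ⋯ + x^(r-1)`
induces on the sequence `w 0, …, w (r - 1)` of `r`-sections, where `z` plays the role of `x^r`:
the entries up to index `k` are summed as they are, the later ones wrap around and pick up a
factor `z`. -/
def cyclicSum {R : Type*} [CommRing R] (r : ℕ) (z : R) (w : ℕ → R) (k : ℕ) : R :=
  ∑ j ∈ Finset.range (k + 1), w j + z * ∑ j ∈ Finset.Ico (k + 1) r, w j

/-- The transformation `cyclicSum` preserves the sector condition. For `k < l` split the indices
into three blocks with sums `C`, `B`, `A`; the two entries are then `C + z (B + A)` and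
`C + B + z A`, and everything is a combination of nonnegative terms. -/
theorem SectorOrdered.cyclicSum {z : ℂ} {r : ℕ} {w : ℕ → ℂ} (hz : 0 < z.im)
    (hw : SectorOrdered z r w) : SectorOrdered z r (cyclicSum r z w) := by
  intro k l hkl hlr
  have h1 := hw.sum (s := .range (k + 1)) (t := .Ico (k + 1) (l + 1))
    (by simp; omega) (by simp; omega)
  have h2 := hw.sum (s := .range (k + 1)) (t := .Ico (l + 1) r) (by simp; omega) (by simp)
  have h3 := hw.sum (s := .Ico (k + 1) (l + 1)) (t := .Ico (l + 1) r) (by simp; omega) (by simp)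
  have hk : _root_.cyclicSum r z w k = ∑ j ∈ Finset.range (k + 1), w j +
      z * (∑ j ∈ Finset.Ico (k + 1) (l + 1), w j + ∑ j ∈ Finset.Ico (l + 1) r, w j) := by
    rw [Finset.sum_Ico_consecutive _ (by omega) (by omega)]; rfl
  have hl : _root_.cyclicSum r z w l = ∑ j ∈ Finset.range (k + 1), w j +
      ∑ j ∈ Finset.Ico (k + 1) (l + 1), w j + z * ∑ j ∈ Finset.Ico (l + 1) r, w j := by
    rw [Finset.sum_range_add_sum_Ico _ (by omega)]; rfl
  rw [hk, hl]
  generalize ∑ j ∈ Finset.range (k + 1), w j = C at *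
  generalize ∑ j ∈ Finset.Ico (k + 1) (l + 1), w j = B at *
  generalize ∑ j ∈ Finset.Ico (l + 1) r, w j = A at *
  have e1 : ((C + z * (B + A)) * conj (C + B + z * A)).im =
      (C * conj B).im + (z * B * conj C).im + (z * A * conj B).im +
        Complex.normSq z * (B * conj A).im + z.im * Complex.normSq B := by
    simp [Complex.normSq_apply]; ring
  -- The cross terms of `A` and `C` have no sign of their own; they complete the square
  -- `‖z A + C‖²`.
  have e2 : (z * (C + B + z * A) * conj (C + z * (B + A))).im =
      Complex.normSq z * ((C * conj B).im + (z * A * conj B).im + (B * conj A).im) +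
        (z * B * conj C).im +
        z.im * Complex.normSq (z * A + C) := by
    simp [Complex.normSq_apply]; ring
  have hn := Complex.normSq_nonneg z
  have hB := Complex.normSq_nonneg B
  have hAC := Complex.normSq_nonneg (z * A + C)
  obtain ⟨h1, h1'⟩ := h1
  obtain ⟨h2, h2'⟩ := h2
  obtain ⟨h3, h3'⟩ := h3
  rw [e1, e2]
  constructor <;> positivity

/-! ### Sections and their values on the upper half-plane -/

theorem veroneseU_zero {r : ℕ} (hr : 0 < r) (k : ℕ) {h : ℝ[X]}
    (hdeg : h.natDegree ≤ r) :
    veroneseU 0 r k h = if k = 0 then C (h.coeff 0) + C (h.coeff r) * X else C (h.coeff k) := by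
  ext i
  rw [veroneseU, coeff_veroneseSection hr, pow_zero, one_mul]
  have hbig : ∀ m, r < m → h.coeff m = 0 := fun m hm =>
    coeff_eq_zero_of_natDegree_lt (hdeg.trans_lt hm)
  match i with
  | 0 => split_ifs with h0 <;> simp [h0]
  | 1 =>
    split_ifs with h0
    · simp [h0]
    · rw [hbig _ (by omega), coeff_C, if_neg one_ne_zero]
  | i + 2 =>
    rw [hbig _ (by nlinarith)]
    split_ifs <;> simp

/-- Multiplication by `1 + x + ⋯ + x^(r-1)` acts on `r`-sections as `cyclicSum`. -/
theorem geom_sum_mul_sum_pow_mul {R : Type*} [CommRing R] (r : ℕ) (x : R) (g : ℕ → R) :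
    (∑ i ∈ Finset.range r, x ^ i) * ∑ k ∈ Finset.range r, x ^ k * g k =
      ∑ k ∈ Finset.range r, x ^ k * cyclicSum r (x ^ r) g k := by
  have hl : ∀ j ∈ Finset.range r, (∑ i ∈ Finset.range r, x ^ i) * (x ^ j * g j) =
      (∑ k ∈ Finset.Ico j r, x ^ k + ∑ k ∈ Finset.range j, x ^ k * x ^ r) * g j := by
    intro j hj
    rw [Finset.mem_range] at hj
    have h1 : ∑ k ∈ Finset.range j, x ^ k * x ^ r = ∑ k ∈ Finset.Ico r (j + r), x ^ k := by
      simp [Finset.sum_Ico_eq_sum_range, pow_add, mul_comm]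
    rw [h1, Finset.sum_Ico_consecutive _ hj.le (by omega), Finset.sum_Ico_eq_sum_range,
      Nat.add_sub_cancel_left, ← mul_assoc, Finset.sum_mul]
    simp [pow_add, mul_comm]
  rw [Finset.mul_sum, Finset.sum_congr rfl hl]
  simp only [cyclicSum, mul_add, add_mul, Finset.sum_add_distrib, Finset.mul_sum, Finset.sum_mul]
  congr 1
  · rw [Finset.sum_comm' (t' := Finset.range r) (s' := fun k => Finset.range (k + 1))]
    intro a b; simp; omega
  · rw [Finset.sum_comm' (t' := Finset.range r) (s' := fun k => Finset.Ico (k + 1) r)]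
    · simp [mul_assoc]
    · intro a b; simp; omega

theorem veroneseU_succ {r : ℕ} (hr : 0 < r) (n : ℕ) {k : ℕ} (hk : k < r) (h : ℝ[X]) :
    veroneseU (n + 1) r k h = cyclicSum r X (fun j => veroneseU n r j h) k := by
  symm
  refine veroneseSection_unique hr _ (cyclicSum r X (fun j => veroneseU n r j h)) ?_ k hk
  have h1 := sum_veroneseSection hr ((∑ i ∈ Finset.range r, (X : ℝ[X]) ^ i) ^ n * h)
  rw [pow_succ', mul_assoc, h1, geom_sum_mul_sum_pow_mul]
  refine Finset.sum_congr rfl fun k _ => ?_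
  simp [cyclicSum, veroneseU]

theorem coeff_veroneseU_nonneg {r : ℕ} (hr : 0 < r) (n k : ℕ) {h : ℝ[X]}
    (hnonneg : ∀ i, 0 ≤ h.coeff i) (i : ℕ) : 0 ≤ (veroneseU n r k h).coeff i := by
  rw [veroneseU, coeff_veroneseSection hr]
  generalize r * i + k = m
  induction n generalizing m with
  | zero => simpa using hnonneg m
  | succ n ih =>
    rw [pow_succ', mul_assoc, coeff_mul]
    refine Finset.sum_nonneg fun p _ => mul_nonneg ?_ (ih _)
    rw [finsetSum_coeff]
    exact Finset.sum_nonneg fun j _ => by rw [coeff_X_pow]; positivity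

theorem aeval_cyclicSum (z : ℂ) (r : ℕ) (f : ℕ → ℝ[X]) (k : ℕ) :
    aeval z (cyclicSum r X f k) = cyclicSum r z (fun j => aeval z (f j)) k := by
  simp [cyclicSum]

theorem sectorOrdered_veroneseU (n : ℕ) {r : ℕ} (hr : 0 < r) {h : ℝ[X]}
    (hnonneg : ∀ i, 0 ≤ h.coeff i) (hdeg : h.natDegree ≤ r) {z : ℂ} (hz : 0 < z.im) :
    SectorOrdered z r (fun k => aeval z (veroneseU n r k h)) := by
  induction n with
  | zero =>
    intro k l hkl hlr
    have h1 := mul_nonneg (hnonneg l) (hnonneg k)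
    have h2 := mul_nonneg (hnonneg r) (hnonneg l)
    simp only [veroneseU_zero hr _ hdeg,
      if_neg (Nat.ne_zero_of_lt hkl)]
    split_ifs with h0
    · subst h0
      constructor
      · simp
        nlinarith
      · simp
        nlinarith
    · constructor
      · simp
      · simp
        nlinarith
  | succ n ih =>
    have := ih.cyclicSum hz
    intro k l hkl hlr
    simp only [veroneseU_succ hr n (hkl.trans hlr), veroneseU_succ hr n hlr, aeval_cyclicSum]
    exact this k l hkl hlr

/-- A nonzero `U^n_{r,k} h` has no zero in the upper half-plane. In the inductive step a zero of
`cyclicSum` at `z` forces the two partial sums, hence all the summands, to vanish at `z`. -/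
theorem veroneseU_eq_zero_of_aeval_eq_zero (n : ℕ) {r : ℕ} (hr : 0 < r) {h : ℝ[X]}
    (hnonneg : ∀ i, 0 ≤ h.coeff i) (hdeg : h.natDegree ≤ r) {z : ℂ} (hz : 0 < z.im)
    {k : ℕ} (hk : k < r) (h0 : aeval z (veroneseU n r k h) = 0) : veroneseU n r k h = 0 := by
  induction n generalizing k with
  | zero =>
    rw [veroneseU_zero hr k hdeg] at h0 ⊢
    split_ifs at h0 ⊢ with hk0
    · have him := congrArg Complex.im h0
      have hre := congrArg Complex.re h0
      simp [hz.ne'] at him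
      simp [him] at hre
      simp [him, hre]
    · simpa using h0
  | succ n ih =>
    have hs := sectorOrdered_veroneseU n hr hnonneg hdeg hz
    rw [veroneseU_succ hr n hk] at h0 ⊢
    rw [aeval_cyclicSum, cyclicSum] at h0
    have hA := eq_zero_of_add_mul_eq_zero hz h0
      (hs.sum (by simp; omega) (by simp)).1
    have hC := h0
    rw [hA, mul_zero, add_zero] at hC
    have hA' := hs.eq_zero_of_sum_eq_zero hz _ (by simp) hA
    have hC' := hs.eq_zero_of_sum_eq_zero hz _ (by simp; omega) hC
    rw [cyclicSum, Finset.sum_eq_zero fun j hj => ih (by simp at hj; omega) (hC' j hj),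
      Finset.sum_eq_zero fun j hj => ih (by simp at hj; omega) (hA' j hj)]
    simp

/-! ### Continuous arguments of real-rooted polynomials -/

/-- The sum of the arguments of `z - u` over `u ∈ s`. For `z` off the real axis it is a choice of the
argument of `∏ (z - u)` that is continuous in each open half-plane. -/
noncomputable def argSum (s : Multiset ℝ) (z : ℂ) : ℝ := (s.map fun u : ℝ => (z - u).arg).sum

theorem exists_prod_sub_eq_mul_exp_argSum (s : Multiset ℝ) {z : ℂ} (hz : z.im ≠ 0) :
    ∃ ρ : ℝ, 0 < ρ ∧ (s.map fun u : ℝ => z - u).prod = ρ * Complex.exp (argSum s z * Complex.I) := by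
  induction s using Multiset.induction_on with
  | empty => exact ⟨1, one_pos, by simp [argSum]⟩
  | cons u s ih =>
    obtain ⟨ρ, hρ, h⟩ := ih
    have hne : z - u ≠ 0 := fun h => hz (by simpa using congrArg Complex.im h)
    refine ⟨‖z - u‖ * ρ, mul_pos (norm_pos_iff.2 hne) hρ, ?_⟩
    rw [Multiset.map_cons, Multiset.prod_cons, h, argSum, argSum, Multiset.map_cons,
      Multiset.sum_cons]
    nth_rw 1 [← Complex.norm_mul_exp_arg_mul_I (z - u)]
    push_cast
    rw [add_mul, Complex.exp_add]
    ring

theorem exists_aeval_eq_mul_exp_argSum {f : ℝ[X]} (hf : RealRooted f) (hlc : 0 < f.leadingCoeff)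
    {z : ℂ} (hz : z.im ≠ 0) :
    ∃ ρ : ℝ, 0 < ρ ∧ aeval z f = ρ * Complex.exp (argSum f.roots z * Complex.I) := by
  obtain ⟨ρ, hρ, h⟩ := exists_prod_sub_eq_mul_exp_argSum f.roots hz
  refine ⟨f.leadingCoeff * ρ, mul_pos hlc hρ, ?_⟩
  have hz' := congrArg (aeval z) (Splits.eq_prod_roots hf)
  rw [hz', map_mul, aeval_C, map_multiset_prod, Multiset.map_map]
  simp only [Function.comp_def, map_sub, aeval_X, aeval_C, Complex.coe_algebraMap]
  rw [h]
  push_cast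
  ring

theorem sin_argSum_sub_nonneg {f g : ℝ[X]} (hf : RealRooted f) (hg : RealRooted g)
    (hlf : 0 < f.leadingCoeff) (hlg : 0 < g.leadingCoeff) {z : ℂ} (hz : z.im ≠ 0)
    (h : 0 ≤ (aeval z f * conj (aeval z g)).im) :
    0 ≤ Real.sin (argSum f.roots z - argSum g.roots z) := by
  obtain ⟨ρ, hρ, h1⟩ := exists_aeval_eq_mul_exp_argSum hf hlf hz
  obtain ⟨σ, hσ, h2⟩ := exists_aeval_eq_mul_exp_argSum hg hlg hz
  have h3 : (aeval z f * conj (aeval z g)).im =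
      ρ * σ * Real.sin (argSum f.roots z - argSum g.roots z) := by
    rw [h1, h2, Real.sin_sub]
    simp [Complex.exp_ofReal_mul_I_re, Complex.exp_ofReal_mul_I_im]
    ring
  rw [h3] at h
  exact nonneg_of_mul_nonneg_right h (by positivity)

theorem continuous_argSum_horizontal (s : Multiset ℝ) {ε : ℝ} (hε : 0 < ε) :
    Continuous fun x : ℝ => argSum s (x + ε * Complex.I) := by
  refine continuous_multiset_sum s fun u _ => ?_
  refine continuous_iff_continuousAt.2 fun x => ?_
  refine (Complex.continuousAt_arg ?_).comp (by fun_prop)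
  right
  simp [hε.ne']

theorem tendsto_argSum_horizontal (s : Multiset ℝ) (ε : ℝ) :
    Tendsto (fun x : ℝ => argSum s (x + ε * Complex.I)) atTop (𝓝 0) := by
  have h0 : (s.map fun _ : ℝ => (0 : ℝ)).sum = 0 := by simp
  rw [← h0]
  refine tendsto_multiset_sum s fun u _ => ?_
  have h1 : Tendsto (fun x : ℝ => (1 + ((ε / (x - u) : ℝ) : ℂ) * Complex.I).arg) atTop
      (𝓝 0) := by
    have h2 : Tendsto (fun x : ℝ => ε / (x - u)) atTop (𝓝 0) :=
      Tendsto.div_atTop tendsto_const_nhds (tendsto_atTop_add_const_right _ (-u) tendsto_id)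
    have h3 : Tendsto (fun x : ℝ => 1 + ((ε / (x - u) : ℝ) : ℂ) * Complex.I) atTop (𝓝 1) := by
      have := (((Complex.continuous_ofReal.tendsto 0).comp h2).mul_const Complex.I).const_add 1
      simpa using this
    have h4 := (Complex.continuousAt_arg (x := 1) (by simp)).tendsto.comp h3
    simpa [Function.comp_def] using h4
  refine h1.congr' ?_
  filter_upwards [eventually_gt_atTop u] with x hx
  have hx' : 0 < x - u := sub_pos.2 hx
  rw [← Complex.arg_real_mul _ hx']
  congr 1
  have : ((x : ℂ) - u) ≠ 0 := by exact_mod_cast hx'.ne'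
  push_cast
  field_simp
  ring

/-- As `z` approaches a real point `x` from above, a factor `z - u` contributes `π` if `x < u` and
`0` if `u < x`. -/
theorem tendsto_argSum_vertical (s : Multiset ℝ) {x : ℝ} (hx : x ∉ s) :
    Tendsto (fun ε : ℝ => argSum s (x + ε * Complex.I)) (𝓝[>] 0)
      (𝓝 (Real.pi * s.countP (x < ·))) := by
  have h0 : Real.pi * s.countP (x < ·) = (s.map fun u => if x < u then Real.pi else 0).sum := by
    clear hx
    induction s using Multiset.induction_on with
    | empty => simp
    | cons u s ih =>
      rw [Multiset.map_cons, Multiset.sum_cons, ← ih, Multiset.countP_cons]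
      split_ifs <;> push_cast <;> ring
  rw [h0]
  refine tendsto_multiset_sum s fun u hu => ?_
  have hxu : x ≠ u := fun h => hx (h ▸ hu)
  have hc : Tendsto (fun ε : ℝ => (x + ε * Complex.I - u : ℂ)) (𝓝[>] 0) (𝓝 ((x - u : ℝ) : ℂ)) := by
    have : Continuous fun ε : ℝ => (x + ε * Complex.I - u : ℂ) := by fun_prop
    simpa using (this.tendsto 0).mono_left nhdsWithin_le_nhds
  split_ifs with hlt
  · have hlim : Tendsto Complex.arg (𝓝[{z : ℂ | 0 ≤ z.im}] ((x - u : ℝ) : ℂ)) (𝓝 Real.pi) :=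
      Complex.tendsto_arg_nhdsWithin_im_nonneg_of_re_neg_of_im_zero
        (by simpa using hlt) (by simp)
    refine hlim.comp (tendsto_nhdsWithin_iff.2 ⟨hc, ?_⟩)
    filter_upwards [self_mem_nhdsWithin] with ε hε
    simpa using le_of_lt hε
  · have hpos : 0 < x - u := sub_pos.2 (lt_of_le_of_ne (not_lt.1 hlt) hxu.symm)
    have := (Complex.continuousAt_arg (x := ((x - u : ℝ) : ℂ))
      (Or.inl (by simpa using hpos))).tendsto.comp hc
    rwa [Complex.arg_ofReal_of_nonneg hpos.le] at this

/-- The set `{t | 0 ≤ sin t}` is a union of disjoint intervals `[2πm, (2m+1)π]`; a continuous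
function with values in it that tends to `0` stays in `[0, π]`. -/
theorem mem_Icc_zero_pi_of_sin_nonneg {φ : ℝ → ℝ} (hc : Continuous φ)
    (hlim : Tendsto φ atTop (𝓝 0)) (hs : ∀ x, 0 ≤ Real.sin (φ x)) (x : ℝ) :
    φ x ∈ Set.Icc 0 Real.pi := by
  have hpi := Real.pi_pos
  have hev : ∀ᶠ y in atTop, φ y ∈ Set.Ioo (-Real.pi / 2) (Real.pi / 2) :=
    hlim.eventually (Ioo_mem_nhds (by linarith) (by linarith))
  obtain ⟨y, hy⟩ := hev.exists
  have hivt : ∀ c, φ x ≤ c ∧ c ≤ φ y ∨ φ y ≤ c ∧ c ≤ φ x → 0 ≤ Real.sin c := by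
    intro c hcase
    have : c ∈ Set.range φ := by
      rcases hcase with h | h
      · exact mem_range_of_exists_le_of_exists_ge hc ⟨x, h.1⟩ ⟨y, h.2⟩
      · exact mem_range_of_exists_le_of_exists_ge hc ⟨y, h.1⟩ ⟨x, h.2⟩
    obtain ⟨t, rfl⟩ := this
    exact hs t
  constructor
  · by_contra hneg
    have hneg := not_le.1 hneg
    -- Otherwise `φ` takes a value in `(-π, 0)`, by the intermediate value theorem.
    have hm : 0 ≤ Real.sin (max (φ x) (-Real.pi / 2)) := by
      rcases le_total (φ x) (-Real.pi / 2) with h | h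
      · rw [max_eq_right h]
        exact hivt _ (Or.inl ⟨h, hy.1.le⟩)
      · rw [max_eq_left h]
        exact hs x
    have := Real.sin_neg_of_neg_of_neg_pi_lt (x := max (φ x) (-Real.pi / 2))
      (max_lt hneg (by linarith)) (lt_max_of_lt_right (by linarith))
    linarith
  · by_contra hgt
    have hgt := not_le.1 hgt
    -- Otherwise `φ` takes a value in `(π, 2π)`.
    have hm : 0 ≤ Real.sin (min (φ x) (3 * Real.pi / 2)) := by
      rcases le_total (φ x) (3 * Real.pi / 2) with h | h
      · rw [min_eq_left h]
        exact hs x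
      · rw [min_eq_right h]
        exact hivt _ (Or.inr ⟨by linarith [hy.2], h⟩)
    have h1 : Real.pi < min (φ x) (3 * Real.pi / 2) := lt_min hgt (by linarith)
    have h2 : min (φ x) (3 * Real.pi / 2) ≤ 3 * Real.pi / 2 := min_le_right _ _
    have := Real.sin_pos_of_pos_of_lt_pi (x := min (φ x) (3 * Real.pi / 2) - Real.pi)
      (by linarith) (by linarith)
    rw [Real.sin_sub_pi] at this
    linarith

/-- The numbers of zeros of `f` and `g` beyond a real point `x` are the boundary values of their
arguments divided by `π`, so they differ by `0` or `1` if the argument of `f / g` stays in `[0, π]`. -/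
theorem countP_roots_of_im_nonneg {f g : ℝ[X]} (hf : RealRooted f) (hg : RealRooted g)
    (hlf : 0 < f.leadingCoeff) (hlg : 0 < g.leadingCoeff)
    (h : ∀ z : ℂ, 0 < z.im → 0 ≤ (aeval z f * conj (aeval z g)).im) {x : ℝ}
    (hxf : x ∉ f.roots) (hxg : x ∉ g.roots) :
    g.roots.countP (x < ·) ≤ f.roots.countP (x < ·) ∧
      f.roots.countP (x < ·) ≤ g.roots.countP (x < ·) + 1 := by
  have hpi := Real.pi_pos
  have hmem : ∀ ε : ℝ, 0 < ε → argSum f.roots (x + ε * Complex.I) -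
      argSum g.roots (x + ε * Complex.I) ∈ Set.Icc 0 Real.pi := by
    intro ε hε
    refine mem_Icc_zero_pi_of_sin_nonneg (φ := fun x : ℝ => argSum f.roots (x + ε * Complex.I) -
      argSum g.roots (x + ε * Complex.I)) ((continuous_argSum_horizontal _ hε).sub
        (continuous_argSum_horizontal _ hε)) ?_ (fun y => ?_) x
    · simpa using (tendsto_argSum_horizontal f.roots ε).sub (tendsto_argSum_horizontal g.roots ε)
    · have him : ((y : ℂ) + ε * Complex.I).im = ε := by simp
      exact sin_argSum_sub_nonneg hf hg hlf hlg (by rw [him]; exact hε.ne')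
        (h _ (by rw [him]; exact hε))
  have hlim := (tendsto_argSum_vertical f.roots hxf).sub (tendsto_argSum_vertical g.roots hxg)
  have := isClosed_Icc.mem_of_tendsto hlim
    (by filter_upwards [self_mem_nhdsWithin] with ε hε using hmem ε hε)
  rw [← mul_sub] at this
  constructor
  · have h1 : (0 : ℝ) ≤ f.roots.countP (x < ·) - g.roots.countP (x < ·) :=
      nonneg_of_mul_nonneg_right this.1 hpi
    exact_mod_cast sub_nonneg.1 h1
  · have h1 : (f.roots.countP (x < ·) : ℝ) - g.roots.countP (x < ·) ≤ 1 :=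
      le_of_mul_le_mul_left (by linarith [this.2]) hpi
    exact_mod_cast (sub_le_iff_le_add'.1 h1)

/-! ### From counting zeros to interlacing -/

theorem lt_countP_of_lt_getElem {l : List ℝ} (hl : l.Pairwise (fun a b => b ≤ a)) {i : ℕ}
    (hi : i < l.length) {x : ℝ} (hx : x < l[i]) : i < l.countP (x < ·) := by
  induction l generalizing i with
  | nil => simp at hi
  | cons a l ih =>
    rw [List.pairwise_cons] at hl
    rw [List.countP_cons]
    cases i with
    | zero => simp at hx; simp [hx]
    | succ i =>
      simp only [List.getElem_cons_succ] at hx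
      have hi' : i < l.length := by simpa using hi
      have ha : x < a := hx.trans_le (hl.1 _ (List.getElem_mem hi'))
      simpa [ha] using ih hl.2 hi' hx

theorem countP_le_of_getElem_lt {l : List ℝ} (hl : l.Pairwise (fun a b => b ≤ a)) {i : ℕ}
    (hi : i < l.length) {x : ℝ} (hx : l[i] < x) : l.countP (x < ·) ≤ i := by
  induction l generalizing i with
  | nil => simp at hi
  | cons a l ih =>
    rw [List.pairwise_cons] at hl
    cases i with
    | zero =>
      simp only [List.getElem_cons_zero] at hx
      rw [Nat.le_zero, List.countP_eq_zero]
      intro b hb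
      rcases List.mem_cons.1 hb with rfl | hb
      · simpa using hx.le
      · simpa using (hl.1 b hb).trans hx.le
    | succ i =>
      simp only [List.getElem_cons_succ] at hx
      rw [List.countP_cons]
      have := ih hl.2 (by simpa using hi) hx
      split_ifs <;> omega

/-- If `f / g` maps the upper half-plane into its closure, then `g` interlaces `f`. -/
theorem interlaces_of_im_nonneg {f g : ℝ[X]} (hf : RealRooted f) (hg : RealRooted g)
    (hlf : 0 < f.leadingCoeff) (hlg : 0 < g.leadingCoeff)
    (h : ∀ z : ℂ, 0 < z.im → 0 ≤ (aeval z f * conj (aeval z g)).im) : Interlaces g f := by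
  have hcount : ∀ x : ℝ, x ∉ f.roots → x ∉ g.roots → _ := fun x hxf hxg =>
    countP_roots_of_im_nonneg hf hg hlf hlg h hxf hxg
  have hlist : ∀ (p : ℝ[X]) (x : ℝ), p.roots.countP (x < ·) = (zerosDesc p).countP (x < ·) := by
    intro p x
    rw [← Multiset.coe_countP, zerosDesc, Multiset.sort_eq]
  have hsorted : ∀ p : ℝ[X], (zerosDesc p).Pairwise (fun a b => b ≤ a) := fun p =>
    Multiset.pairwise_sort _ _
  have hbetween : ∀ a b : ℝ, a < b → ∃ x, a < x ∧ x < b ∧ x ∉ f.roots ∧ x ∉ g.roots := by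
    intro a b hab
    obtain ⟨x, hx, hx'⟩ := (Set.Ioo_infinite hab).exists_notMem_finset
      (f.roots.toFinset ∪ g.roots.toFinset)
    simp only [Finset.mem_union, Multiset.mem_toFinset, not_or] at hx'
    exact ⟨x, hx.1, hx.2, hx'⟩
  refine ⟨hg, hf, Or.inr (Or.inr ⟨hlg, hlf, ?_, fun i hv hu => ?_, fun i hv hu => ?_⟩)⟩
  -- The degrees are compared by counting zeros beyond a point below all of them.
  · obtain ⟨m, hm⟩ := (f.roots.toFinset ∪ g.roots.toFinset).bddBelow
    have hlow : ∀ p : ℝ[X], (∀ u ∈ p.roots, m ≤ u) →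
        p.roots.countP (m - 1 < ·) = p.roots.card ∧ m - 1 ∉ p.roots := by
      intro p hp
      refine ⟨Multiset.countP_eq_card.2 fun u hu => by linarith [hp u hu], fun hu => ?_⟩
      linarith [hp _ hu]
    obtain ⟨hf1, hf2⟩ := hlow f fun u hu => hm <| Finset.mem_coe.2 <|
      Finset.mem_union_left _ (Multiset.mem_toFinset.2 hu)
    obtain ⟨hg1, hg2⟩ := hlow g fun u hu => hm <| Finset.mem_coe.2 <|
      Finset.mem_union_right _ (Multiset.mem_toFinset.2 hu)
    have := hcount (m - 1) hf2 hg2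
    rw [hf1, hg1, ← Splits.natDegree_eq_card_roots hf, ← Splits.natDegree_eq_card_roots hg] at this
    omega
  · by_contra hlt
    obtain ⟨x, h1, h2, hxf, hxg⟩ := hbetween _ _ (not_le.1 hlt)
    have hx := (hcount x hxf hxg).1
    rw [hlist, hlist] at hx
    have := lt_countP_of_lt_getElem (hsorted g) hv h2
    have := countP_le_of_getElem_lt (hsorted f) hu h1
    omega
  · by_contra hlt
    obtain ⟨x, h1, h2, hxf, hxg⟩ := hbetween _ _ (not_le.1 hlt)
    have hx := (hcount x hxf hxg).2
    rw [hlist, hlist] at hx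
    have := lt_countP_of_lt_getElem (hsorted f) hu h2
    have := countP_le_of_getElem_lt (hsorted g) hv h1
    omega

/-! ### Interlacing of the sections -/

theorem realRooted_of_forall_aeval_ne_zero {p : ℝ[X]}
    (hp : ∀ z : ℂ, 0 < z.im → aeval z p ≠ 0) : RealRooted p := by
  refine Splits.of_splits_map (algebraMap ℝ ℂ) (IsAlgClosed.splits _) fun a ha => ?_
  have ha0 : aeval a p = 0 := by
    rw [aeval_def, ← eval_map]
    exact (mem_roots'.1 ha).2
  rcases lt_trichotomy a.im 0 with h | h | h
  · refine absurd ?_ (hp (conj a) (by simpa using h))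
    rw [aeval_conj, ha0, map_zero]
  · exact ⟨a.re, Complex.ext (by simp) (by simp [h])⟩
  · exact absurd ha0 (hp a h)

theorem leadingCoeff_pos_of_coeff_nonneg {p : ℝ[X]} (hp : ∀ i, 0 ≤ p.coeff i) (h0 : p ≠ 0) :
    0 < p.leadingCoeff :=
  (hp _).lt_of_ne (leadingCoeff_ne_zero.2 h0).symm

theorem corollary3p1 (n r : ℕ) (hr : 0 < r) (h : Polynomial ℝ)
    (hnonneg : ∀ i, 0 ≤ h.coeff i) (hdeg : h.natDegree ≤ r) :
    IsInterlacingSeq (fun i : Fin r => veroneseU n r (r - 1 - (i : ℕ)) h) ∧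
      ∀ j : ℕ, j < r → RealRooted (veroneseU n r j h) := by
  have hreal : ∀ j : ℕ, j < r → RealRooted (veroneseU n r j h) := by
    intro j hj
    by_cases h0 : veroneseU n r j h = 0
    · rw [h0]
      exact Splits.zero
    · exact realRooted_of_forall_aeval_ne_zero fun z hz hz0 =>
        h0 (veroneseU_eq_zero_of_aeval_eq_zero n hr hnonneg hdeg hz hj hz0)
  have hlc : ∀ j, veroneseU n r j h ≠ 0 → 0 < (veroneseU n r j h).leadingCoeff := fun j =>
    leadingCoeff_pos_of_coeff_nonneg (coeff_veroneseU_nonneg hr n j hnonneg)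
  refine ⟨⟨fun i => or_iff_not_imp_left.2 (hlc _), fun i j hij => ?_⟩, hreal⟩
  have hij' : (i : ℕ) < j := hij
  have hj := j.isLt
  have hri := hreal (r - 1 - i) (by omega)
  have hrj := hreal (r - 1 - j) (by omega)
  by_cases hi0 : veroneseU n r (r - 1 - i) h = 0
  · exact ⟨hri, hrj, Or.inl hi0⟩
  by_cases hj0 : veroneseU n r (r - 1 - j) h = 0
  · exact ⟨hri, hrj, Or.inr (Or.inl hj0)⟩
  exact interlaces_of_im_nonneg hrj hri (hlc _ hj0) (hlc _ hi0) fun z hz =>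
    (sectorOrdered_veroneseU n hr hnonneg hdeg hz _ _ (by omega) (by omega)).1
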